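/- A biquandle is a non-empty set $X$ with a bijection $R=(R_1,R_2)\colon X\times X\to X\times X$ such that $(R\times\mathrm{id})(\mathrm{id}\times R)(R\times\mathrm{id})=(\mathrm{id}\times R)(R\times\mathrm{id})(\mathrm{id}\times R)$; for all $x,z$ there is a unique $y$ with $R_1(x,y)=z$; for all $y,w$ there is a unique $x$ with $R_2(x,y)=w$; and for every $a$ there is a unique $x$ with $R(x,a)=(x,a)$. A virtual biquandle $(X,f,R)$ is a biquandle $(X,R)$ with a bijection $f\colon X\to X$ such that $R\circ(f\times f)=(f\times f)\circ R$. Then $VR(x,y)=(R_1(x,f(y)),R_2(f^{-1}(x),y))$ makes $(X,VR)$ a biquandle. An oriented virtual link diagram $D$ is a generic smooth immersion of finitely many oriented circles into the Euclidean plane $\mathbb{R}^2$ or the sphere $S^2$ (finitely many double points, all transverse, and no triple points), each double point being decorated either as a classical crossing (with over/under information) or as a virtual crossing. Its semiarcs are the pieces into which the preimages of the double points cut the circles (a circle without double points is one semiarc). Draw each crossing with both strands running downwards, let $x,y$ be the labels of the top left and the top right (incoming) semiarc and $(x',y')$ those of the bottom left and the bottom right (outgoing) semiarc. A classical crossing is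 positive if the velocities of the over-arc and the under-arc, in this order, form a positively oriented basis, that is, if the strand from top right to bottom left passes over; otherwise it is negative. A coloring of $D$ by a biquandle $(X,R)$ is a labeling of the semiarcs by elements of $X$ such that $(x',y')=R(x,y)$ at positive crossings, $(x',y')=R^{-1}(x,y)$ at negative crossings, and $(x',y')=(y,x)$ at virtual crossings. A coloring of $D$ by a virtual biquandle $(X,f,R)$ is a labeling obeying the same rules at the classical crossings and $(x',y')=(f^{-1}(y),f(x))$ at virtual crossings. Theorem. Let $(X,f,R)$ be a virtual biquandle and let $D$ be an oriented virtual link diagram in $\mathbb{R}^2$ or in $S^2$. Then the set of colorings of $D$ by the virtual biquandle $(X,f,R)$ is in bijection with the set of colorings of $D$ by the biquandle $(X,VR)$. -/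

import Mathlib

open scoped ContDiff Topology

namespace VirtualKnot

/-- A biquandle structure on `X`: an invertible Yang-Baxter operator
`R (x, y) = (R₁ (x, y), R₂ (x, y))` with `R₁` left-invertible, `R₂` right-invertible and
satisfying the type I condition. -/
structure Biquandle (X : Type*) where
  nonempty : Nonempty X
  R : X × X ≃ X × X
  /-- `(R × id)(id × R)(R × id) = (id × R)(R × id)(id × R)` on `X × X × X`. -/
  yang_baxter :
    let RI : X × X × X → X × X × X := fun t =>
      ((R (t.1, t.2.1)).1, (R (t.1, t.2.1)).2, t.2.2)
    let IR : X × X × X → X × X × X := fun t => (t.1, R t.2)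
    RI ∘ IR ∘ RI = IR ∘ RI ∘ IR
  left_inv : ∀ x z : X, ∃! y : X, (R (x, y)).1 = z
  right_inv : ∀ y w : X, ∃! x : X, (R (x, y)).2 = w
  type_one : ∀ a : X, ∃! x : X, R (x, a) = (x, a)

/-- A virtual biquandle `(X, f, R)`: a biquandle `(X, R)` with an automorphism `f`. -/
structure VirtualBiquandle (X : Type*) extends Biquandle X where
  f : X ≃ X
  map_R : ∀ x y : X, R (f x, f y) = (f (R (x, y)).1, f (R (x, y)).2)

namespace VirtualBiquandle

variable {X : Type*} (V : VirtualBiquandle X)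

/-- The operator `VR (x, y) = (R₁ (x, f y), R₂ (f⁻¹ x, y))`, as a bijection of `X × X`. -/
def VR : X × X ≃ X × X where
  toFun z := ((V.R (z.1, V.f z.2)).1, (V.R (V.f.symm z.1, z.2)).2)
  invFun z := (V.f (V.R.symm (V.f.symm z.1, z.2)).1, (V.R.symm (V.f.symm z.1, z.2)).2)
  left_inv z := by
    have h := V.map_R (V.f.symm z.1) z.2
    simp only [Equiv.apply_symm_apply] at h
    simp [h]
  right_inv z := by
    have h := V.map_R (V.R.symm (V.f.symm z.1, z.2)).1 (V.R.symm (V.f.symm z.1, z.2)).2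
    simp [h]

theorem map_R_symm (x y : X) :
    V.R (V.f.symm x, V.f.symm y) = (V.f.symm (V.R (x, y)).1, V.f.symm (V.R (x, y)).2) := by
  have h := V.map_R (V.f.symm x) (V.f.symm y)
  simp only [Equiv.apply_symm_apply] at h
  simp [h]

/-- The biquandle `(X, VR)`. -/
def twist : Biquandle X where
  nonempty := V.nonempty
  R := V.VR
  yang_baxter := by
    intro RI IR
    funext t
    obtain ⟨x, y, z⟩ := t
    have h := congrFun V.yang_baxter (x, V.f y, V.f (V.f z))
    simp only [Function.comp, Prod.ext_iff] at h
    obtain ⟨h1, h2, h3⟩ := h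
    have e : ∀ a b, (V.R (V.f a, V.f b)) = (V.f (V.R (a, b)).1, V.f (V.R (a, b)).2) := V.map_R
    have es : ∀ a b, V.R (V.f.symm a, b) =
        (V.f.symm (V.R (a, V.f b)).1, V.f.symm (V.R (a, V.f b)).2) := by
      intro a b
      have := V.map_R_symm a (V.f b)
      simpa using this
    simp only [Function.comp, RI, IR, VR, Equiv.coe_fn_mk, es, e, Equiv.apply_symm_apply,
      Prod.ext_iff, EmbeddingLike.apply_eq_iff_eq] at h1 h2 h3 ⊢
    refine ⟨h1, ?_, ?_⟩
    · simpa [es, e] using congrArg V.f.symm h2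
    · simpa [es, e] using congrArg (fun a => V.f.symm (V.f.symm a)) h3
  left_inv x z := by
    obtain ⟨y, hy, hu⟩ := V.left_inv x z
    refine ⟨V.f.symm y, by simpa [VR] using hy, fun w hw => ?_⟩
    rw [Equiv.eq_symm_apply]
    exact hu _ (by simpa [VR] using hw)
  right_inv y w := by
    obtain ⟨x, hx, hu⟩ := V.right_inv y w
    refine ⟨V.f x, by simpa [VR] using hx, fun z hz => ?_⟩
    rw [← Equiv.symm_apply_eq]
    exact hu _ (by simpa [VR] using hz)
  type_one a := by
    obtain ⟨x, hx, hu⟩ := V.type_one (V.f a)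
    have key : ∀ z, V.VR (z, a) = (z, a) ↔ V.R (z, V.f a) = (z, V.f a) := by
      intro z
      have := V.map_R (V.f.symm z) a
      simp only [Equiv.apply_symm_apply] at this
      simp [VR, this]
    exact ⟨x, (key x).2 hx, fun z hz => hu z ((key z).1 hz)⟩

end VirtualBiquandle

/-- The disjoint union of `n` oriented circles, each one being `ℝ / ℤ`. -/
abbrev Circles (n : ℕ) : Type := Fin n × UnitAddCircle

/-- The point reached from `p` after running along its circle for time `s`. -/
def Circles.shift {n : ℕ} (p : Circles n) (s : ℝ) : Circles n :=
  (p.1, p.2 + (s : UnitAddCircle))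

/-- An oriented virtual link diagram on an oriented surface `S` embedded in `E`: a generic
smooth immersion `γ` of finitely many oriented circles whose double points are decorated.
The orientation of `S` is given by `area`: a basis `(u, v)` of the tangent plane at `x` is
positive if and only if `0 < area x u v`. -/
structure LinkDiagram {E : Type} [NormedAddCommGroup E] [NormedSpace ℝ E]
    (S : Set E) (area : E → E → E → ℝ) where
  /-- the number of circles -/
  n : ℕ
  γ : Circles n → E
  mem_surface : ∀ p, γ p ∈ S
  smooth : ∀ i, ContDiff ℝ ∞ (fun t : ℝ => γ (i, (t : UnitAddCircle)))
  immersion : ∀ p : Circles n, deriv (fun s : ℝ => γ (p.shift s)) 0 ≠ 0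
  finite_double : {p | ∃ q, q ≠ p ∧ γ q = γ p}.Finite
  no_triple : ∀ p q r, p ≠ q → q ≠ r → p ≠ r → γ p = γ q → γ q ≠ γ r
  transverse : ∀ p q : Circles n, p ≠ q → γ p = γ q →
    LinearIndependent ℝ
      ![deriv (fun s : ℝ => γ (p.shift s)) 0, deriv (fun s : ℝ => γ (q.shift s)) 0]
  /-- A double point is virtual if it lies in this set, and classical otherwise. -/
  virt : Set E
  /-- Of the two branches of a classical crossing, the one in this set is the over-arc. -/
  overArc : Set (Circles n)
  overArc_spec : ∀ p q, p ≠ q → γ p = γ q → γ p ∉ virt → (p ∈ overArc ↔ q ∉ overArc)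

namespace LinkDiagram

variable {E : Type} [NormedAddCommGroup E] [NormedSpace ℝ E]
  {S : Set E} {area : E → E → E → ℝ} (D : LinkDiagram S area)

/-- The velocity vector of the diagram at `p`. -/
noncomputable def velocity (p : Circles D.n) : E := deriv (fun s : ℝ => D.γ (p.shift s)) 0

/-- The points of the circles that are sent to double points. -/
def doubleSet : Set (Circles D.n) := {p | ∃ q, q ≠ p ∧ D.γ q = D.γ p}

/-- The semiarcs: the connected pieces into which the preimages of the double points cut the
circles (a circle without double points is one semiarc). -/
def Semiarc : Type := ConnectedComponents {p : Circles D.n // p ∉ D.doubleSet}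

/-- The semiarc `a` contains the point `p` of the circles. -/
def OnSemiarc (a : D.Semiarc) (p : Circles D.n) : Prop :=
  ∃ h : p ∉ D.doubleSet, (ConnectedComponents.mk ⟨p, h⟩ : D.Semiarc) = a

/-- The semiarc `a` is the one that runs into `p`. -/
def RunsInto (a : D.Semiarc) (p : Circles D.n) : Prop :=
  ∀ᶠ s : ℝ in 𝓝[>] 0, D.OnSemiarc a (p.shift (-s))

/-- The semiarc `a` is the one that starts from `p`. -/
def StartsFrom (a : D.Semiarc) (p : Circles D.n) : Prop :=
  ∀ᶠ s : ℝ in 𝓝[>] 0, D.OnSemiarc a (p.shift s)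

/-- The branches at `p` and `q` meet in a crossing. When the crossing is drawn with both strands
running downwards, the branch at `p` runs from the top left to the bottom right and the branch
at `q` from the top right to the bottom left. -/
def Crossing (p q : Circles D.n) : Prop :=
  p ≠ q ∧ D.γ p = D.γ q ∧ area (D.γ p) (D.velocity p) (D.velocity q) < 0

/-- The labels of the semiarcs obey the rules `pos`, `neg`, `vir` at the positive, the negative
and the virtual crossings. A rule sends the labels (top left, top right) of the incoming
semiarcs to the labels (bottom left, bottom right) of the outgoing ones. A classical crossing is
positive if the pair (velocity of the over-arc, velocity of the under-arc) is a positive basis,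
that is, if the branch from the top right to the bottom left is the over-arc. -/
def ObeysRules {X : Type*} (pos neg vir : X × X → X × X) (c : D.Semiarc → X) : Prop :=
  ∀ p q, D.Crossing p q → ∀ topLeft topRight botLeft botRight : D.Semiarc,
    D.RunsInto topLeft p → D.RunsInto topRight q →
    D.StartsFrom botLeft q → D.StartsFrom botRight p →
      (D.γ p ∉ D.virt → q ∈ D.overArc →
        (c botLeft, c botRight) = pos (c topLeft, c topRight)) ∧
      (D.γ p ∉ D.virt → p ∈ D.overArc →
        (c botLeft, c botRight) = neg (c topLeft, c topRight)) ∧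
      (D.γ p ∈ D.virt →
        (c botLeft, c botRight) = vir (c topLeft, c topRight))

/-- The colorings of `D` by a biquandle: `R` at positive crossings, its inverse at negative
crossings, and `(x, y) ↦ (y, x)` at virtual crossings. -/
def biquandleColorings {X : Type*} (B : Biquandle X) : Set (D.Semiarc → X) :=
  {c | D.ObeysRules B.R B.R.symm Prod.swap c}

/-- The colorings of `D` by a virtual biquandle: `R` at positive crossings, its inverse at
negative crossings, and `(x, y) ↦ (f⁻¹ y, f x)` at virtual crossings. -/
def virtualBiquandleColorings {X : Type*} (V : VirtualBiquandle X) : Set (D.Semiarc → X) :=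
  {c | D.ObeysRules V.R V.R.symm (fun z => (V.f.symm z.2, V.f z.1)) c}

end LinkDiagram

/-- Oriented virtual link diagrams in the Euclidean plane with its standard orientation. -/
abbrev PlaneLinkDiagram : Type :=
  LinkDiagram (E := EuclideanSpace ℝ (Fin 2)) Set.univ
    (fun _ u v => u 0 * v 1 - u 1 * v 0)

/-- Oriented virtual link diagrams in the unit sphere of Euclidean 3-space, oriented by the
outward normal. -/
abbrev SphereLinkDiagram : Type :=
  LinkDiagram (E := EuclideanSpace ℝ (Fin 3)) (Metric.sphere 0 1)
    (fun x u v => Matrix.det !![x 0, x 1, x 2; u 0, u 1, u 2; v 0, v 1, v 2])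

end VirtualKnot

/-! Number the semiarcs by integers so that at every crossing, drawn downwards, the two left
semiarcs carry some k + 1 and the two right ones carry k. Acting on each label by the power of f
given by the number of its semiarc turns one set of rules into the other: since f commutes with R,
VR (f^(k+1) x, f^k y) = (f^(k+1) R₁(x, y), f^k R₂(x, y)), likewise for the inverses, and the rule
(f⁻¹ y, f x) becomes the plain swap. These maps are invertible, whence `IsNumbering.coloringsEquiv`.

The numbering comes from planarity: up to sign it is the winding number of the whole curve around
its own point Γ p. The chord Γ q - Γ p vanishes at q = p; dividing it by the corresponding chord of
the unit circle removes this zero. The resulting `index` is constant along semiarcs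
(`eventually_index_eq`) and jumps by one, in opposite directions, along the two branches of a double
point (`exists_index_near_double_point`). Whether a crossing is virtual, or which branch is over,
plays no role here. A curve on the sphere misses a point, and stereographic projection from that
point reduces to the plane. -/

namespace VirtualKnot

/-! ### Winding numbers of loops around the origin. -/

open Complex in
/-- The loop `f` has a continuous logarithm which increases by `2πik` along the loop. -/
def HasLoopWinding (f : UnitAddCircle → ℂ) (k : ℤ) : Prop :=
  ∃ L : ℝ → ℂ, Continuous L ∧ (∀ t : ℝ, exp (L t) = f t) ∧ L 1 - L 0 = k * (2 * Real.pi * I)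

namespace HasLoopWinding

variable {f g : UnitAddCircle → ℂ} {k l : ℤ}

/-- The exponential is a covering of the punctured plane, so the loop lifts along ℝ; the end values
of the lift have the same exponential. -/
theorem exists_of_continuous (hf : Continuous f) (h0 : ∀ t, f t ≠ 0) :
    ∃ k, HasLoopWinding f k := by
  have hc : Continuous fun t : ℝ => f t := hf.comp (AddCircle.continuous_mk' 1)
  obtain ⟨L, ⟨-, hL⟩, -⟩ := Complex.isCoveringMapOn_exp.existsUnique_continuousMap_lifts
    ⟨fun t : ℝ => f t, hc⟩ (a₀ := 0) (e₀ := Complex.log (f (0 : ℝ)))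
    (Complex.exp_log (h0 _)) (fun t => h0 t)
  have hL' : ∀ t : ℝ, Complex.exp (L t) = f t := fun t => congrFun hL t
  have h1 : Complex.exp (L 1) = Complex.exp (L 0) := by
    rw [hL', hL']
    congr 1
    simp
  obtain ⟨k, hk⟩ := Complex.exp_eq_exp_iff_exists_int.1 h1
  exact ⟨k, L, L.continuous, hL', by rw [hk]; ring⟩

theorem mul (hf : HasLoopWinding f k) (hg : HasLoopWinding g l) :
    HasLoopWinding (f * g) (k + l) := by
  obtain ⟨L, hL, hLf, hk⟩ := hf
  obtain ⟨M, hM, hMg, hl⟩ := hg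
  refine ⟨L + M, hL.add hM, fun t => by simp [Complex.exp_add, hLf, hMg], ?_⟩
  simp only [Pi.add_apply]
  push_cast
  linear_combination hk + hl

theorem of_mem_slitPlane (hf : Continuous f) (h : ∀ t, f t ∈ Complex.slitPlane) :
    HasLoopWinding f 0 := by
  have hc : Continuous fun t : ℝ => f t := hf.comp (AddCircle.continuous_mk' 1)
  refine ⟨fun t => Complex.log (f t), hc.clog fun t => h t,
    fun t => Complex.exp_log (Complex.slitPlane_ne_zero (h t)), ?_⟩
  have : ((1 : ℝ) : UnitAddCircle) = ((0 : ℝ) : UnitAddCircle) := by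
    simp
  simp [this]

theorem const {c : ℂ} (hc : c ≠ 0) : HasLoopWinding (fun _ => c) 0 :=
  ⟨fun _ => Complex.log c, continuous_const, fun _ => Complex.exp_log hc, by simp⟩

/-- Two logarithms differ by 2πi times a continuous integer-valued function on ℝ, which is constant.
-/
theorem unique (hk : HasLoopWinding f k) (hl : HasLoopWinding f l) : k = l := by
  obtain ⟨L, hL, hLf, hk⟩ := hk
  obtain ⟨M, hM, hMf, hl⟩ := hl
  have hpi : (2 * Real.pi * Complex.I : ℂ) ≠ 0 := Complex.two_pi_I_ne_zero
  have key : ∀ t, ∃ m : ℤ, (L t - M t) / (2 * Real.pi * Complex.I) = m := by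
    intro t
    obtain ⟨m, hm⟩ := Complex.exp_eq_exp_iff_exists_int.1 ((hLf t).trans (hMf t).symm)
    exact ⟨m, by rw [hm]; field_simp; ring⟩
  choose m hm using key
  have hmc : Continuous m := by
    have h1 : Continuous fun t => ((m t : ℝ) : ℂ) := by
      have : (fun t => ((m t : ℝ) : ℂ)) = fun t => (L t - M t) / (2 * Real.pi * Complex.I) := by
        funext t
        rw [hm]; simp
      rw [this]
      fun_prop
    have h2 : Continuous fun t => (m t : ℝ) := by
      exact Complex.continuous_re.comp h1
    exact (Int.isClosedEmbedding_coe_real.isEmbedding.continuous_iff).2 h2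
  have h01 : m 1 = m 0 := PreconnectedSpace.constant inferInstance hmc
  have e1 := hm 1
  have e0 := hm 0
  rw [h01, ← e0, div_left_inj' hpi] at e1
  have : ((k : ℂ) - l) * (2 * Real.pi * Complex.I) = 0 := by
    linear_combination e1 - hk + hl
  rcases mul_eq_zero.1 this with h | h
  · exact_mod_cast sub_eq_zero.1 h
  · exact absurd h hpi

end HasLoopWinding

/-- The standard embedding of `ℝ / ℤ` as the unit circle of `ℂ`. -/
noncomputable def unitCircleMap (t : UnitAddCircle) : ℂ := (AddCircle.toCircle t : ℂ)

theorem unitCircleMap_coe (t : ℝ) :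
    unitCircleMap t = Complex.exp (2 * Real.pi * Complex.I * t) := by
  simp only [unitCircleMap, AddCircle.toCircle_apply_mk, Circle.coe_exp]
  congr 1
  push_cast
  ring

theorem continuous_unitCircleMap : Continuous unitCircleMap :=
  continuous_subtype_val.comp AddCircle.continuous_toCircle

theorem norm_unitCircleMap (t : UnitAddCircle) : ‖unitCircleMap t‖ = 1 :=
  Circle.norm_coe _

theorem unitCircleMap_ne_zero (t : UnitAddCircle) : unitCircleMap t ≠ 0 :=
  Circle.coe_ne_zero _

theorem unitCircleMap_injective : Function.Injective unitCircleMap :=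
  Subtype.val_injective.comp (AddCircle.injective_toCircle one_ne_zero)

theorem unitCircleMap_add (s t : UnitAddCircle) :
    unitCircleMap (s + t) = unitCircleMap s * unitCircleMap t := by
  simp [unitCircleMap, AddCircle.toCircle_add]

theorem hasLoopWinding_unitCircleMap : HasLoopWinding unitCircleMap 1 :=
  ⟨fun t => 2 * Real.pi * Complex.I * t, by fun_prop, fun t => (unitCircleMap_coe t).symm, by simp⟩

theorem one_sub_mem_slitPlane {z : ℂ} (h : ‖z‖ < 1) : 1 - z ∈ Complex.slitPlane := by
  left
  have := (Complex.abs_re_le_norm z).trans_lt h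
  simp only [Complex.sub_re, Complex.one_re]
  linarith [(abs_lt.1 this).2]

/-- Write u - c = u (1 - c/u); the second factor stays in the right half-plane. For ‖c‖ > 1 the
factorization is -c (1 - u/c) instead. -/
theorem hasLoopWinding_sub_of_norm_lt_one {c : ℂ} (hc : ‖c‖ < 1) :
    HasLoopWinding (fun t => unitCircleMap t - c) 1 := by
  have h : HasLoopWinding (fun t => 1 - c / unitCircleMap t) 0 :=
    .of_mem_slitPlane
      (continuous_const.sub (continuous_const.div continuous_unitCircleMap unitCircleMap_ne_zero))
      fun t => one_sub_mem_slitPlane (by rwa [norm_div, norm_unitCircleMap, div_one])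
  rw [← add_zero (1 : ℤ)]
  convert hasLoopWinding_unitCircleMap.mul h using 1
  funext t
  have := unitCircleMap_ne_zero t
  simp only [Pi.mul_apply]
  field_simp

theorem hasLoopWinding_sub_of_one_lt_norm {c : ℂ} (hc : 1 < ‖c‖) :
    HasLoopWinding (fun t => unitCircleMap t - c) 0 := by
  have hc0 : c ≠ 0 := norm_pos_iff.1 (one_pos.trans hc)
  have h : HasLoopWinding (fun t => 1 - unitCircleMap t / c) 0 :=
    .of_mem_slitPlane (continuous_const.sub (continuous_unitCircleMap.div_const c))
      fun t => one_sub_mem_slitPlane (by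
        rw [norm_div, norm_unitCircleMap]; exact (div_lt_one (one_pos.trans hc)).2 hc)
  rw [← add_zero (0 : ℤ)]
  convert (HasLoopWinding.const (neg_ne_zero.2 hc0)).mul h using 1
  funext t
  simp only [Pi.mul_apply]
  field_simp
  ring

open Classical in
/-- The winding number around `0` of a family of loops. -/
noncomputable def winding {n : ℕ} (f : Circles n → ℂ) : ℤ :=
  ∑ i, if h : ∃ k, HasLoopWinding (fun t => f (i, t)) k then h.choose else 0

theorem winding_eq {n : ℕ} {f : Circles n → ℂ} {k : Fin n → ℤ}
    (h : ∀ i, HasLoopWinding (fun t => f (i, t)) (k i)) : winding f = ∑ i, k i := by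
  refine Finset.sum_congr rfl fun i _ => ?_
  rw [dif_pos ⟨k i, h i⟩]
  exact HasLoopWinding.unique (Exists.choose_spec (⟨k i, h i⟩ : ∃ k, _)) (h i)

theorem winding_mul {n : ℕ} {f g : Circles n → ℂ} (hf : Continuous f) (hg : Continuous g)
    (hf0 : ∀ q, f q ≠ 0) (hg0 : ∀ q, g q ≠ 0) :
    winding (f * g) = winding f + winding g := by
  have hi : ∀ i : Fin n, Continuous fun t : UnitAddCircle => ((i, t) : Circles n) := fun i => by
    fun_prop
  choose k hk using fun i => HasLoopWinding.exists_of_continuous (hf.comp (hi i)) fun _ => hf0 _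
  choose l hl using fun i => HasLoopWinding.exists_of_continuous (hg.comp (hi i)) fun _ => hg0 _
  rw [winding_eq hk, winding_eq hl, winding_eq fun i => (hk i).mul (hl i), Finset.sum_add_distrib]

theorem winding_of_mem_slitPlane {n : ℕ} {f : Circles n → ℂ} (hf : Continuous f)
    (h : ∀ q, f q ∈ Complex.slitPlane) : winding f = 0 := by
  have hi : ∀ i : Fin n, Continuous fun t : UnitAddCircle => ((i, t) : Circles n) := fun i => by
    fun_prop
  rw [winding_eq fun i => HasLoopWinding.of_mem_slitPlane (hf.comp (hi i)) fun _ => h _]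
  simp

/-- A form of Rouché's theorem, through which every comparison of indices passes. -/
theorem winding_eq_of_div_mem_slitPlane {n : ℕ} {f g : Circles n → ℂ} (hf : Continuous f)
    (hg : Continuous g) (hg0 : ∀ q, g q ≠ 0) (h : ∀ q, f q / g q ∈ Complex.slitPlane) :
    winding f = winding g := by
  have e : f = (f / g) * g := by
    funext q
    simp [hg0 q]
  rw [e, winding_mul (hf.div hg hg0) hg (fun q => Complex.slitPlane_ne_zero (h q)) hg0,
    winding_of_mem_slitPlane (hf.div hg hg0) h, zero_add]

/-- On the circle of `p` this is the distance vector from the point `r` times `p` of the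
plane, and on the other circles it is `1`. -/
noncomputable def factor {n : ℕ} (p : Circles n) (r : ℂ) (q : Circles n) : ℂ :=
  if q.1 = p.1 then unitCircleMap q.2 - r * unitCircleMap p.2 else 1

theorem continuous_ite_fst {n : ℕ} {Y : Type*} [TopologicalSpace Y] (i : Fin n)
    {f g : Circles n → Y} (hf : Continuous f) (hg : Continuous g) :
    Continuous fun q : Circles n => if q.1 = i then f q else g q := by
  refine continuous_if (fun a ha => ?_) hf.continuousOn hg.continuousOn
  have : IsClopen {q : Circles n | q.1 = i} := (isClopen_discrete {i}).preimage continuous_fst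
  simp [this.frontier_eq] at ha

theorem continuous_factor {n : ℕ} (p : Circles n) (r : ℂ) : Continuous (factor p r) :=
  continuous_ite_fst p.1
    ((continuous_unitCircleMap.comp continuous_snd).sub continuous_const) continuous_const

theorem factor_ne_zero {n : ℕ} (p : Circles n) {r : ℂ} (hr : ‖r‖ ≠ 1) (q : Circles n) :
    factor p r q ≠ 0 := by
  unfold factor
  split_ifs
  · intro h
    apply hr
    have := congrArg norm (sub_eq_zero.1 h)
    simpa [norm_unitCircleMap] using this.symm
  · exact one_ne_zero

theorem factor_one_eq_zero_iff {n : ℕ} {p q : Circles n} : factor p 1 q = 0 ↔ q = p := by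
  unfold factor
  split_ifs with h
  · rw [one_mul, sub_eq_zero, unitCircleMap_injective.eq_iff, Prod.ext_iff]
    simp [h]
  · simp only [one_ne_zero, false_iff]
    rintro rfl
    exact h rfl

theorem winding_factor_of_norm_lt_one {n : ℕ} (p : Circles n) {r : ℂ} (hr : ‖r‖ < 1) :
    winding (factor p r) = 1 := by
  rw [winding_eq (k := fun i => if i = p.1 then 1 else 0)]
  · simp
  · intro i
    by_cases h : i = p.1
    · simpa [factor, h] using hasLoopWinding_sub_of_norm_lt_one
        (c := r * unitCircleMap p.2) (by simpa [norm_unitCircleMap] using hr)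
    · simpa [factor, h] using HasLoopWinding.const one_ne_zero

theorem winding_factor_of_one_lt_norm {n : ℕ} (p : Circles n) {r : ℂ} (hr : 1 < ‖r‖) :
    winding (factor p r) = 0 := by
  rw [winding_eq (k := fun i => 0)]
  · simp
  · intro i
    by_cases h : i = p.1
    · simpa [factor, h] using hasLoopWinding_sub_of_one_lt_norm
        (c := r * unitCircleMap p.2) (by simpa [norm_unitCircleMap] using hr)
    · simpa [factor, h] using HasLoopWinding.const one_ne_zero

end VirtualKnot

/-! ### Regular curves, desingularized chords and the index. -/

namespace VirtualKnot

open Filter Asymptotics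

/-- Both ends of the difference quotient move, hence strict differentiability. The field is ℝ for
the curves and ℂ for the exponential in the analysis of double points. -/
theorem HasStrictDerivAt.tendsto_quotient {𝕜 α : Type*} [NontriviallyNormedField 𝕜]
    [NormedAlgebra 𝕜 ℂ] {f : 𝕜 → ℂ} {f' : ℂ} {x : 𝕜} (h : HasStrictDerivAt f f' x)
    {l : Filter α} {a b : α → 𝕜} (ha : Tendsto a l (𝓝 x)) (hb : Tendsto b l (𝓝 x))
    (hab : ∀ᶠ i in l, a i ≠ b i) :
    Tendsto (fun i => (f (a i) - f (b i)) / algebraMap 𝕜 ℂ (a i - b i)) l (𝓝 f') := by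
  have h1 := (h.hasStrictFDerivAt.isLittleO).comp_tendsto (ha.prodMk_nhds hb)
  have h2 : (fun i => f (a i) - f (b i) - algebraMap 𝕜 ℂ (a i - b i) * f') =o[l]
      fun i => algebraMap 𝕜 ℂ (a i - b i) := by
    refine IsLittleO.of_norm_right ?_
    simp only [norm_algebraMap']
    refine IsLittleO.norm_right ?_
    simpa [Function.comp_def, Algebra.smul_def] using h1
  have h3 := h2.tendsto_div_nhds_zero.add_const f'
  rw [zero_add] at h3
  refine h3.congr' ?_
  filter_upwards [hab] with i hi
  have : algebraMap 𝕜 ℂ (a i - b i) ≠ 0 := by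
    simpa [sub_eq_zero] using hi
  field_simp
  ring

namespace Circles

variable {n : ℕ}

@[simp] theorem shift_fst (p : Circles n) (s : ℝ) : (p.shift s).1 = p.1 := rfl

@[simp] theorem shift_zero (p : Circles n) : p.shift 0 = p := by simp [shift]

theorem shift_shift (p : Circles n) (s t : ℝ) : (p.shift s).shift t = p.shift (s + t) := by
  simp [shift, add_assoc]

theorem continuous_shift (p : Circles n) : Continuous p.shift :=
  continuous_const.prodMk (continuous_const.add (AddCircle.continuous_mk' 1))

theorem tendsto_shift (p : Circles n) : Tendsto p.shift (𝓝 0) (𝓝 p) := by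
  simpa using p.continuous_shift.tendsto 0

theorem nhds_eq_map_shift (p : Circles n) : 𝓝 p = map p.shift (𝓝 0) := by
  have h : IsOpenMap p.shift := by
    have h1 : IsOpenMap fun s : ℝ => p.2 + (s : UnitAddCircle) :=
      (isOpenMap_add_left p.2).comp QuotientAddGroup.isOpenMap_coe
    have h2 : IsOpenMap fun t : UnitAddCircle => ((p.1, t) : Circles n) := by
      intro U hU
      have : (fun t : UnitAddCircle => ((p.1, t) : Circles n)) '' U = {p.1} ×ˢ U := by
        ext q
        simp [Prod.ext_iff, Set.mem_prod, and_comm, eq_comm]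
      rw [this]
      exact (isOpen_discrete _).prod hU
    exact h2.comp h1
  have := h.map_nhds_eq (x := 0) p.continuous_shift.continuousAt
  rw [this, shift_zero]

theorem shift_eq_shift_iff (p : Circles n) :
    ∀ᶠ z : ℝ × ℝ in 𝓝 (0, 0), p.shift z.1 = p.shift z.2 ↔ z.1 = z.2 := by
  -- An interval of length 1, the period, embeds in the circle.
  have h : Set.Ioo (-(1/2) : ℝ) (1/2) ∈ 𝓝 (0 : ℝ) := Ioo_mem_nhds (by norm_num) (by norm_num)
  filter_upwards [prod_mem_nhds h h] with z hz
  have e : ∀ x ∈ Set.Ioo (-(1/2) : ℝ) (1/2), x ∈ Set.Ico (-(1/2) : ℝ) (-(1/2) + 1) := by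
    intro x hx
    exact ⟨hx.1.le, hx.2.trans_le (by norm_num)⟩
  simp [shift, AddCircle.coe_eq_coe_iff_of_mem_Ico (e _ hz.1) (e _ hz.2)]

end Circles

theorem hasStrictDerivAt_unitCircleMap_shift {n : ℕ} (p : Circles n) :
    HasStrictDerivAt (fun s : ℝ => unitCircleMap (p.shift s).2)
      (2 * Real.pi * Complex.I * unitCircleMap p.2) 0 := by
  have e : (fun s : ℝ => unitCircleMap (p.shift s).2) = fun s : ℝ =>
      unitCircleMap p.2 * Complex.exp (2 * Real.pi * Complex.I * s) := by
    funext s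
    rw [Circles.shift, unitCircleMap_add, unitCircleMap_coe]
  have h : HasStrictDerivAt (fun s : ℝ => 2 * Real.pi * Complex.I * (s : ℂ))
      (2 * Real.pi * Complex.I * 1) 0 :=
    (Complex.ofRealCLM.hasStrictFDerivAt.hasStrictDerivAt (x := 0)).const_mul _
  rw [e]
  refine (h.cexp.const_mul (unitCircleMap p.2)).congr_deriv ?_
  rw [Complex.ofReal_zero, mul_zero, Complex.exp_zero]
  ring

/-- A regular closed curve of class `C¹` in the plane, with several components. -/
structure RegularCurve (n : ℕ) where
  toFun : Circles n → ℂ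
  velocity : Circles n → ℂ
  continuous_velocity : Continuous velocity
  hasStrictDerivAt : ∀ p, HasStrictDerivAt (fun s : ℝ => toFun (p.shift s)) (velocity p) 0
  velocity_ne_zero : ∀ p, velocity p ≠ 0

namespace RegularCurve

variable {n : ℕ} (Γ : RegularCurve n)

instance : CoeFun (RegularCurve n) fun _ => Circles n → ℂ := ⟨toFun⟩

theorem continuous : Continuous Γ := by
  refine continuous_iff_continuousAt.2 fun p => ?_
  rw [ContinuousAt, Circles.nhds_eq_map_shift, tendsto_map'_iff]
  simpa [Function.comp_def] using (Γ.hasStrictDerivAt p).hasDerivAt.continuousAt.tendsto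

open Classical in
/-- The chord from `Γ p` to `Γ q`, divided by the corresponding chord of the unit circle if `p`
and `q` lie on the same circle, and extended by continuity to the diagonal. -/
noncomputable def chord (p q : Circles n) : ℂ :=
  if q = p then Γ.velocity p / (2 * Real.pi * Complex.I * unitCircleMap p.2)
  else (Γ q - Γ p) / factor p 1 q

theorem chord_self (p : Circles n) :
    Γ.chord p p = Γ.velocity p / (2 * Real.pi * Complex.I * unitCircleMap p.2) := by
  simp [chord]

theorem chord_of_ne {p q : Circles n} (h : q ≠ p) :
    Γ.chord p q = (Γ q - Γ p) / factor p 1 q := by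
  simp [chord, h]

theorem chord_ne_zero {p q : Circles n} (h : q ≠ p → Γ q ≠ Γ p) : Γ.chord p q ≠ 0 := by
  by_cases hq : q = p
  · subst hq
    rw [chord_self]
    exact div_ne_zero (Γ.velocity_ne_zero _)
      (mul_ne_zero Complex.two_pi_I_ne_zero (unitCircleMap_ne_zero _))
  · rw [chord_of_ne _ hq]
    exact div_ne_zero (sub_ne_zero.2 (h hq)) (factor_one_eq_zero_iff.not.2 hq)

end RegularCurve

theorem continuous_factor_uncurried {n : ℕ} (r : ℂ) :
    Continuous fun z : Circles n × Circles n => factor z.1 r z.2 := by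
  unfold factor
  refine continuous_if (fun a ha => ?_) ?_ continuous_const.continuousOn
  · have : IsClopen {z : Circles n × Circles n | z.2.1 = z.1.1} :=
      (isClopen_discrete {z : Fin n × Fin n | z.1 = z.2}).preimage
        ((continuous_fst.comp continuous_snd).prodMk (continuous_fst.comp continuous_fst))
    simp [this.frontier_eq] at ha
  · exact ((continuous_unitCircleMap.comp (continuous_snd.comp continuous_snd)).sub
      (continuous_const.mul
        (continuous_unitCircleMap.comp (continuous_snd.comp continuous_fst)))).continuousOn

namespace RegularCurve

variable {n : ℕ} (Γ : RegularCurve n)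

/-- Near the diagonal the chord is a quotient of two difference quotients over the same parameter
increment, and strict differentiability gives the limit as both points move. -/
theorem continuous_chord_uncurried :
    Continuous fun z : Circles n × Circles n => Γ.chord z.1 z.2 := by
  refine continuous_iff_continuousAt.2 fun ⟨p, q⟩ => ?_
  by_cases hq : q = p
  · subst hq
    rw [ContinuousAt, nhds_prod_eq, Circles.nhds_eq_map_shift, prod_map_map_eq, tendsto_map'_iff,
      ← nhds_prod_eq]
    have h2 : Tendsto (fun z : ℝ × ℝ => z.1) (𝓝 (0, 0)) (𝓝 0) := continuous_fst.tendsto _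
    have h3 : Tendsto (fun z : ℝ × ℝ => z.2) (𝓝 (0, 0)) (𝓝 0) := continuous_snd.tendsto _
    classical
    have key : Tendsto (fun z : ℝ × ℝ => if z.1 = z.2
        then Γ.velocity (q.shift z.1) / (2 * Real.pi * Complex.I * unitCircleMap (q.shift z.1).2)
        else (Γ (q.shift z.2) - Γ (q.shift z.1)) /
          (unitCircleMap (q.shift z.2).2 - unitCircleMap (q.shift z.1).2)) (𝓝 (0, 0))
        (𝓝 (Γ.chord q q)) := by
      rw [chord_self]
      refine Tendsto.if ?_ ?_
      · refine Tendsto.mono_left ?_ inf_le_left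
        have hs := (Circles.tendsto_shift q).comp h2
        exact ((Γ.continuous_velocity.tendsto q).comp hs).div
          (((continuous_unitCircleMap.comp continuous_snd).tendsto q |>.comp hs).const_mul _)
          (mul_ne_zero Complex.two_pi_I_ne_zero (unitCircleMap_ne_zero _))
      · have hne : ∀ᶠ z : ℝ × ℝ in 𝓝 (0, 0) ⊓ 𝓟 {z | ¬ z.1 = z.2}, z.2 ≠ z.1 :=
          eventually_inf_principal.2 (Eventually.of_forall fun z hz => Ne.symm hz)
        have a1 := HasStrictDerivAt.tendsto_quotient (Γ.hasStrictDerivAt q)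
          (h3.mono_left inf_le_left) (h2.mono_left inf_le_left) hne
        have a2 := HasStrictDerivAt.tendsto_quotient (hasStrictDerivAt_unitCircleMap_shift q)
          (h3.mono_left inf_le_left) (h2.mono_left inf_le_left) hne
        refine (a1.div a2
          (mul_ne_zero Complex.two_pi_I_ne_zero (unitCircleMap_ne_zero _))).congr' ?_
        filter_upwards [hne] with z hz
        have : algebraMap ℝ ℂ (z.2 - z.1) ≠ 0 := by simpa [sub_eq_zero] using hz
        simp only [Pi.div_apply]
        exact div_div_div_cancel_right₀ this _ _
    refine key.congr' ?_
    filter_upwards [Circles.shift_eq_shift_iff q] with z hz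
    simp only [Function.comp_apply, chord, eq_comm (a := q.shift z.2),
      hz, factor, Circles.shift_fst, if_true, one_mul]
  · have hne : ∀ᶠ z : Circles n × Circles n in 𝓝 (p, q), z.2 ≠ z.1 :=
      (isOpen_ne_fun continuous_snd continuous_fst).mem_nhds hq
    have : ContinuousAt (fun z : Circles n × Circles n => (Γ z.2 - Γ z.1) / factor z.1 1 z.2)
        (p, q) :=
      ((Γ.continuous.comp continuous_snd).sub (Γ.continuous.comp continuous_fst)).continuousAt.div
        (continuous_factor_uncurried 1).continuousAt (factor_one_eq_zero_iff.not.2 hq)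
    refine this.congr ?_
    filter_upwards [hne] with z hz
    rw [chord_of_ne _ hz]

theorem continuous_chord (p : Circles n) : Continuous (Γ.chord p) :=
  Γ.continuous_chord_uncurried.comp (continuous_const.prodMk continuous_id)

/-- The sum of the winding numbers around `Γ p` of the components of `Γ`, with a convention for
the component of `p`. -/
noncomputable def index (p : Circles n) : ℤ := winding (Γ.chord p)

/-- The ratio of the chords from p' and from p is close to 1 near each q, and by compactness of the
circles for all q simultaneously. -/
theorem eventually_index_eq {p : Circles n} (h : ∀ q, q ≠ p → Γ q ≠ Γ p) :
    ∀ᶠ p' in 𝓝 p, Γ.index p' = Γ.index p := by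
  have h0 : ∀ q, Γ.chord p q ≠ 0 := fun q => Γ.chord_ne_zero (h q)
  have key : ∀ᶠ p' in 𝓝 p, ∀ q ∈ Set.univ, Γ.chord p' q / Γ.chord p q ∈ Complex.slitPlane := by
    refine isCompact_univ.eventually_forall_of_forall_eventually fun q _ => ?_
    have : ContinuousAt (fun z : Circles n × Circles n => Γ.chord z.1 z.2 / Γ.chord p z.2)
        (p, q) :=
      Γ.continuous_chord_uncurried.continuousAt.div
        ((Γ.continuous_chord p).comp continuous_snd).continuousAt (h0 q)
    refine this.eventually_mem (Complex.isOpen_slitPlane.mem_nhds ?_)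
    rw [div_self (h0 q)]
    exact Complex.one_mem_slitPlane
  filter_upwards [key] with p' hp'
  exact winding_eq_of_div_mem_slitPlane (Γ.continuous_chord p') (Γ.continuous_chord p) h0
    fun q => hp' q trivial

open Classical in
/-- The chords from the double point `Γ p = Γ q`, desingularized at both preimages. -/
noncomputable def doubleChord (p q x : Circles n) : ℂ :=
  if x = q then Γ.chord q q / factor p 1 q else Γ.chord p x / factor q 1 x

variable {p q : Circles n}

theorem doubleChord_of_ne_right {x : Circles n} (hx : x ≠ q) :
    Γ.doubleChord p q x = Γ.chord p x / factor q 1 x := by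
  simp [doubleChord, hx]

theorem doubleChord_of_ne_left (hΓ : Γ p = Γ q) {x : Circles n} (hx : x ≠ p) :
    Γ.doubleChord p q x = Γ.chord q x / factor p 1 x := by
  by_cases h : x = q
  · simp [doubleChord, h]
  · rw [doubleChord_of_ne_right _ h, chord_of_ne _ h, chord_of_ne _ hx, hΓ, div_right_comm]

/-- This symmetry lets the indices along both branches be compared with one and the same winding
number. -/
theorem doubleChord_comm (hpq : p ≠ q) (hΓ : Γ p = Γ q) :
    Γ.doubleChord p q = Γ.doubleChord q p := by
  funext x
  by_cases h : x = p
  · rw [doubleChord_of_ne_right _ (h ▸ hpq), doubleChord_of_ne_left _ hΓ.symm (h ▸ hpq)]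
  · rw [doubleChord_of_ne_left _ hΓ h, doubleChord_of_ne_right _ h]

theorem continuous_doubleChord (hpq : p ≠ q) (hΓ : Γ p = Γ q) :
    Continuous (Γ.doubleChord p q) := by
  refine continuous_iff_continuousAt.2 fun x => ?_
  by_cases h : x = q
  · have hx : x ≠ p := h ▸ hpq.symm
    refine ((Γ.continuous_chord q).continuousAt.div (continuous_factor p 1).continuousAt
      (factor_one_eq_zero_iff.not.2 hx)).congr ?_
    filter_upwards [isOpen_ne.mem_nhds hx] with y hy
    exact (Γ.doubleChord_of_ne_left hΓ hy).symm
  · refine ((Γ.continuous_chord p).continuousAt.div (continuous_factor q 1).continuousAt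
      (factor_one_eq_zero_iff.not.2 h)).congr ?_
    filter_upwards [isOpen_ne.mem_nhds h] with y hy
    exact (Γ.doubleChord_of_ne_right hy).symm

theorem doubleChord_ne_zero (hpq : p ≠ q)
    (h3 : ∀ x, x ≠ p → x ≠ q → Γ x ≠ Γ p) (x : Circles n) : Γ.doubleChord p q x ≠ 0 := by
  by_cases h : x = q
  · subst h
    simp only [doubleChord, if_true]
    exact div_ne_zero (Γ.chord_ne_zero fun h => absurd rfl h)
      (factor_one_eq_zero_iff.not.2 hpq.symm)
  · rw [doubleChord_of_ne_right _ h]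
    exact div_ne_zero (Γ.chord_ne_zero fun hx => h3 x hx h) (factor_one_eq_zero_iff.not.2 h)

end RegularCurve

end VirtualKnot

/-! ### The jump of the index at a double point. -/

namespace VirtualKnot

open Filter Asymptotics

/-- The norm `|s| + |t|` is controlled by `‖t - z s‖` when `z` is not real. -/
theorem isBigO_sub_mul_ofReal {z : ℂ} (hz : z.im ≠ 0) (l : Filter (ℝ × ℝ)) :
    ((fun w : ℝ × ℝ => w.1) =O[l] fun w : ℝ × ℝ => (w.2 : ℂ) - z * w.1) ∧
    ((fun w : ℝ × ℝ => w.2) =O[l] fun w : ℝ × ℝ => (w.2 : ℂ) - z * w.1) := by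
  have h1 : (fun w : ℝ × ℝ => w.1) =O[l] fun w : ℝ × ℝ => (w.2 : ℂ) - z * w.1 := by
    refine IsBigO.of_bound |z.im|⁻¹ (Eventually.of_forall fun w => ?_)
    have := Complex.abs_im_le_norm ((w.2 : ℂ) - z * w.1)
    simp only [Complex.sub_im, Complex.ofReal_im, Complex.mul_im, Complex.ofReal_re, mul_zero,
      zero_add, zero_sub, abs_neg, abs_mul] at this
    rw [inv_mul_eq_div, le_div_iff₀ (abs_pos.2 hz), mul_comm, Real.norm_eq_abs]
    exact this
  refine ⟨h1, ?_⟩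
  have h2 : (fun w : ℝ × ℝ => z * w.1) =O[l] fun w : ℝ × ℝ => (w.2 : ℂ) - z * w.1 := by
    refine IsBigO.const_mul_left ?_ z
    refine IsBigO.of_norm_left ?_
    simpa using h1.norm_left
  have h3 := (isBigO_refl (fun w : ℝ × ℝ => (w.2 : ℂ) - z * w.1) l).add h2
  refine IsBigO.of_norm_left ?_
  simpa using h3.norm_left

theorem sub_mul_ofReal_ne_zero {z : ℂ} (hz : z.im ≠ 0) {s : ℝ} (hs : s ≠ 0) (t : ℝ) :
    (t : ℂ) - z * s ≠ 0 := by
  intro h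
  have := congrArg Complex.im h
  simp [hz, hs] at this

theorem factor_exp_shift {n : ℕ} (q : Circles n) (w : ℂ) (t : ℝ) :
    factor q (Complex.exp (2 * Real.pi * Complex.I * w)) (q.shift t) = unitCircleMap q.2 *
      (Complex.exp (2 * Real.pi * Complex.I * t) - Complex.exp (2 * Real.pi * Complex.I * w)) := by
  simp only [factor, Circles.shift_fst, if_true]
  rw [Circles.shift, unitCircleMap_add, unitCircleMap_coe]
  ring

theorem tendsto_factor_exp_div {n : ℕ} (q : Circles n) {z : ℂ} (hz : z.im ≠ 0) :
    Tendsto (fun w : ℝ × ℝ =>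
      factor q (Complex.exp (2 * Real.pi * Complex.I * (z * w.1))) (q.shift w.2) /
        ((w.2 : ℂ) - z * w.1)) (𝓝 (0, 0) ⊓ 𝓟 {w | w.1 ≠ 0})
      (𝓝 (2 * Real.pi * Complex.I * unitCircleMap q.2)) := by
  have h : HasStrictDerivAt (fun w : ℂ => Complex.exp (2 * Real.pi * Complex.I * w))
      (2 * Real.pi * Complex.I) 0 := by
    have := ((hasStrictDerivAt_id (0 : ℂ)).const_mul (2 * Real.pi * Complex.I)).cexp
    simpa using this
  have h1 : Tendsto (fun w : ℝ × ℝ => (w.2 : ℂ)) (𝓝 (0, 0)) (𝓝 0) := by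
    have : Continuous fun w : ℝ × ℝ => (w.2 : ℂ) := by fun_prop
    simpa using this.tendsto (0, 0)
  have h2 : Tendsto (fun w : ℝ × ℝ => z * w.1) (𝓝 (0, 0)) (𝓝 0) := by
    have : Continuous fun w : ℝ × ℝ => z * w.1 := by fun_prop
    simpa using this.tendsto (0, 0)
  have h3 := (HasStrictDerivAt.tendsto_quotient h (h1.mono_left inf_le_left)
    (h2.mono_left inf_le_left) (l := 𝓝 (0, 0) ⊓ 𝓟 {w : ℝ × ℝ | w.1 ≠ 0})
    (eventually_inf_principal.2 (Eventually.of_forall fun w hw => by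
      simpa [sub_eq_zero] using sub_mul_ofReal_ne_zero hz hw w.2))).const_mul (unitCircleMap q.2)
  rw [mul_comm (2 * Real.pi * Complex.I : ℂ)]
  refine h3.congr fun w => ?_
  rw [factor_exp_shift, mul_div_assoc]
  simp

namespace RegularCurve

variable {n : ℕ} (Γ : RegularCurve n) {p q : Circles n}

/-- To first order Γ (q + t) - Γ (p + s) is t v_q - s v_p = v_q (t - z s) with z = v_p / v_q.
Transversality makes z non-real, so t - z s dominates both error terms. -/
theorem tendsto_sub_div (hΓ : Γ p = Γ q) (hz : (Γ.velocity p / Γ.velocity q).im ≠ 0) :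
    Tendsto (fun w : ℝ × ℝ => (Γ (q.shift w.2) - Γ (p.shift w.1)) /
        ((w.2 : ℂ) - Γ.velocity p / Γ.velocity q * w.1)) (𝓝 (0, 0) ⊓ 𝓟 {w | w.1 ≠ 0})
      (𝓝 (Γ.velocity q)) := by
  obtain ⟨o1, o2⟩ := isBigO_sub_mul_ofReal hz (𝓝 (0, 0) ⊓ 𝓟 {w | w.1 ≠ 0})
  have t1 : Tendsto (fun z : ℝ × ℝ => z.1) (𝓝 (0, 0) ⊓ 𝓟 {w | w.1 ≠ 0}) (𝓝 0) :=
    (continuous_fst.tendsto _).mono_left inf_le_left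
  have t2 : Tendsto (fun z : ℝ × ℝ => z.2) (𝓝 (0, 0) ⊓ 𝓟 {w | w.1 ≠ 0}) (𝓝 0) :=
    (continuous_snd.tendsto _).mono_left inf_le_left
  have d1 := (hasDerivAt_iff_isLittleO_nhds_zero.1 (Γ.hasStrictDerivAt p).hasDerivAt).comp_tendsto
    t1 |>.trans_isBigO o1
  have d2 := (hasDerivAt_iff_isLittleO_nhds_zero.1 (Γ.hasStrictDerivAt q).hasDerivAt).comp_tendsto
    t2 |>.trans_isBigO o2
  have h := (d2.sub d1).tendsto_div_nhds_zero.add_const (Γ.velocity q)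
  rw [zero_add] at h
  refine h.congr' ?_
  filter_upwards [mem_inf_of_right (mem_principal_self _)] with w hw
  have h0 := sub_mul_ofReal_ne_zero hz hw w.2
  rw [div_add' _ _ _ h0]
  congr 1
  have hq := Γ.velocity_ne_zero q
  simp only [Function.comp_apply, zero_add, Circles.shift_zero, Complex.real_smul, hΓ]
  field_simp
  ring

/-- By the first-order expansion, the branch at q meets Γ (p + s) at the complex parameter t = z s.
The chord from p + s is therefore modelled by `doubleChord` times a factor vanishing at the point
exp(2πi z s) `unitCircleMap q.2` near the unit circle. -/
theorem eventually_chord_div_mem_slitPlane (hpq : p ≠ q) (hΓ : Γ p = Γ q)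
    (h3 : ∀ x, x ≠ p → x ≠ q → Γ x ≠ Γ p) (hz : (Γ.velocity p / Γ.velocity q).im ≠ 0) :
    ∀ᶠ s : ℝ in 𝓝[≠] 0, ∀ x, Γ.chord (p.shift s) x / (Γ.doubleChord p q x *
      factor q (Complex.exp (2 * Real.pi * Complex.I * (Γ.velocity p / Γ.velocity q * s))) x) ∈
        Complex.slitPlane := by
  rw [eventually_nhdsWithin_iff]
  have key : ∀ᶠ s : ℝ in 𝓝 0, ∀ x ∈ Set.univ, s ∈ ({0}ᶜ : Set ℝ) →
      Γ.chord (p.shift s) x / (Γ.doubleChord p q x *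
        factor q (Complex.exp (2 * Real.pi * Complex.I * (Γ.velocity p / Γ.velocity q * s))) x) ∈
          Complex.slitPlane := by
    refine isCompact_univ.eventually_forall_of_forall_eventually fun x _ => ?_
    by_cases hx : x = q
    · subst hx
      rw [nhds_prod_eq, Circles.nhds_eq_map_shift x]
      nth_rewrite 1 [← map_id (f := 𝓝 (0 : ℝ))]
      rw [prod_map_map_eq, eventually_map, ← nhds_prod_eq]
      have hpx : factor p 1 x ≠ 0 := factor_one_eq_zero_iff.not.2 hpq.symm
      have hv := Γ.velocity_ne_zero x
      have hpi : (2 * Real.pi * Complex.I : ℂ) ≠ 0 := Complex.two_pi_I_ne_zero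
      have hu := unitCircleMap_ne_zero x.2
      have s1 : Tendsto (fun w : ℝ × ℝ => p.shift w.1) (𝓝 (0, 0)) (𝓝 p) :=
        p.tendsto_shift.comp (continuous_fst.tendsto _)
      have s2 : Tendsto (fun w : ℝ × ℝ => x.shift w.2) (𝓝 (0, 0)) (𝓝 x) :=
        x.tendsto_shift.comp (continuous_snd.tendsto _)
      -- Near x = q the chord and its model are both divided by t - z s; the limits agree, so their
      -- ratio tends to 1.
      have c1 : Tendsto (fun w : ℝ × ℝ => factor (p.shift w.1) 1 (x.shift w.2) *
          Γ.doubleChord p x (x.shift w.2)) (𝓝 (0, 0))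
          (𝓝 (Γ.velocity x / (2 * Real.pi * Complex.I * unitCircleMap x.2))) := by
        have e : factor p 1 x * Γ.doubleChord p x x =
            Γ.velocity x / (2 * Real.pi * Complex.I * unitCircleMap x.2) := by
          rw [Γ.doubleChord_of_ne_left hΓ hpq.symm, chord_self, mul_div_cancel₀ _ hpx]
        rw [← e]
        exact (((continuous_factor_uncurried 1).tendsto (p, x)).comp (s1.prodMk_nhds s2)).mul
          (((Γ.continuous_doubleChord hpq hΓ).tendsto x).comp s2)
      have c2 := ((Γ.tendsto_sub_div hΓ hz).div (tendsto_factor_exp_div x hz)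
        (mul_ne_zero hpi hu)).div (c1.mono_left inf_le_left) (div_ne_zero hv (mul_ne_zero hpi hu))
      rw [div_self (div_ne_zero hv (mul_ne_zero hpi hu))] at c2
      have c3 := c2.eventually_mem
        (Complex.isOpen_slitPlane.mem_nhds Complex.one_mem_slitPlane)
      rw [eventually_inf_principal] at c3
      have hne : ∀ᶠ w : ℝ × ℝ in 𝓝 (0, 0), x.shift w.2 ≠ p.shift w.1 :=
        (s2.prodMk_nhds s1).eventually_mem ((isOpen_ne_fun continuous_fst continuous_snd).mem_nhds
          (show (x, p).1 ≠ (x, p).2 from hpq.symm))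
      filter_upwards [c3, hne] with w hw hw' hw0
      convert hw hw0 using 1
      simp only [Pi.div_apply, id]
      rw [div_div_div_cancel_right₀ (sub_mul_ofReal_ne_zero hz (s := w.1) hw0 _), chord_of_ne _ hw', div_div,
        div_div]
      congr 1
      ring
    · have hf0 : factor q 1 x ≠ 0 := factor_one_eq_zero_iff.not.2 hx
      have hH0 := Γ.doubleChord_ne_zero hpq h3 x
      have hf : Continuous fun w : ℝ × Circles n => factor q (Complex.exp (2 * Real.pi *
          Complex.I * (Γ.velocity p / Γ.velocity q * w.1))) w.2 := by
        unfold factor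
        refine continuous_if (fun a ha => ?_) ?_ continuous_const.continuousOn
        · have : IsClopen {w : ℝ × Circles n | w.2.1 = q.1} :=
            (isClopen_discrete {q.1}).preimage (continuous_fst.comp continuous_snd)
          simp [this.frontier_eq] at ha
        · have := continuous_unitCircleMap
          fun_prop
      have e : factor q (Complex.exp (2 * Real.pi * Complex.I *
          (Γ.velocity p / Γ.velocity q * ((0 : ℝ) : ℂ)))) x = factor q 1 x := by simp
      have hc : ContinuousAt (fun w : ℝ × Circles n => Γ.chord (p.shift w.1) w.2 /
          (Γ.doubleChord p q w.2 * factor q (Complex.exp (2 * Real.pi * Complex.I *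
            (Γ.velocity p / Γ.velocity q * w.1))) w.2)) (0, x) := by
        refine ContinuousAt.div ?_ ?_ ?_
        · exact (Γ.continuous_chord_uncurried.comp
            ((p.continuous_shift.comp continuous_fst).prodMk continuous_snd)).continuousAt
        · exact (((Γ.continuous_doubleChord hpq hΓ).comp continuous_snd).mul hf).continuousAt
        · simp only [e]
          exact mul_ne_zero hH0 hf0
      refine (hc.eventually_mem (Complex.isOpen_slitPlane.mem_nhds ?_)).mono fun w hw _ => hw
      simp only [e, Circles.shift_zero]
      rw [doubleChord_of_ne_right _ hx, div_mul_cancel₀ _ hf0, div_self]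
      · exact Complex.one_mem_slitPlane
      · exact Γ.chord_ne_zero fun h => h3 x h hx
  exact key.mono fun s hs h x => hs x trivial h

theorem eventually_index_shift_eq (hpq : p ≠ q) (hΓ : Γ p = Γ q)
    (h3 : ∀ x, x ≠ p → x ≠ q → Γ x ≠ Γ p) (hz : (Γ.velocity p / Γ.velocity q).im ≠ 0) :
    ∀ᶠ s : ℝ in 𝓝[≠] 0, Γ.index (p.shift s) = winding (Γ.doubleChord p q) +
      if 0 < s * (Γ.velocity p / Γ.velocity q).im then 1 else 0 := by
  filter_upwards [Γ.eventually_chord_div_mem_slitPlane hpq hΓ h3 hz, self_mem_nhdsWithin]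
    with s hs hs0
  set z := Γ.velocity p / Γ.velocity q
  -- The sign of s Im z decides whether the zero of the model lies inside the unit circle,
  -- contributing 1, or outside, contributing 0.
  have hn : ‖Complex.exp (2 * Real.pi * Complex.I * (z * s))‖ =
      Real.exp (-(2 * Real.pi * (s * z.im))) := by
    rw [Complex.norm_exp]
    congr 1
    simp
    ring
  have hsz : s * z.im ≠ 0 := mul_ne_zero hs0 hz
  have hn1 : ‖Complex.exp (2 * Real.pi * Complex.I * (z * s))‖ ≠ 1 := by
    rw [hn, Ne, Real.exp_eq_one_iff]
    simpa [Real.pi_ne_zero, hz] using hs0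
  have hH := Γ.continuous_doubleChord hpq hΓ
  have hH0 := Γ.doubleChord_ne_zero hpq h3
  have h1 : Γ.index (p.shift s) = winding (Γ.doubleChord p q *
      factor q (Complex.exp (2 * Real.pi * Complex.I * (z * s)))) :=
    winding_eq_of_div_mem_slitPlane (Γ.continuous_chord _) (hH.mul (continuous_factor _ _))
      (fun x => mul_ne_zero (hH0 x) (factor_ne_zero _ hn1 _)) hs
  rw [h1, winding_mul hH (continuous_factor _ _) hH0 (factor_ne_zero _ hn1)]
  congr 1
  split_ifs with h
  · refine winding_factor_of_norm_lt_one q ?_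
    rw [hn, Real.exp_lt_one_iff]
    have := Real.pi_pos
    have := mul_pos (mul_pos two_pos this) h
    linarith
  · refine winding_factor_of_one_lt_norm q ?_
    rw [hn, Real.one_lt_exp_iff]
    have := Real.pi_pos
    have h' : s * z.im < 0 := lt_of_le_of_ne (not_lt.1 h) hsz
    have := mul_neg_of_pos_of_neg (mul_pos two_pos this) h'
    linarith

/-- At a double point where the branch of `p` crosses the branch of `q` from its right to its
left, the index increases by `1` along the branch of `p`, and decreases by `1` along the branch
of `q`. -/
theorem exists_index_near_double_point (hpq : p ≠ q) (hΓ : Γ p = Γ q)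
    (h3 : ∀ x, x ≠ p → x ≠ q → Γ x ≠ Γ p) (hz : 0 < (Γ.velocity p / Γ.velocity q).im) :
    ∃ k : ℤ, ∀ᶠ s : ℝ in 𝓝[>] 0, Γ.index (p.shift (-s)) = k ∧ Γ.index (q.shift s) = k ∧
      Γ.index (q.shift (-s)) = k + 1 ∧ Γ.index (p.shift s) = k + 1 := by
  have hz' : (Γ.velocity q / Γ.velocity p).im < 0 := by
    rw [← inv_div, Complex.inv_im]
    refine div_neg_of_neg_of_pos (neg_lt_zero.2 hz) (Complex.normSq_pos.2 fun h => ?_)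
    simp [h] at hz
  have hp := Γ.eventually_index_shift_eq hpq hΓ h3 hz.ne'
  have hq := Γ.eventually_index_shift_eq hpq.symm hΓ.symm
    (fun x h1 h2 => hΓ ▸ h3 x h2 h1) hz'.ne
  rw [← Γ.doubleChord_comm hpq hΓ] at hq
  have hle : (𝓝[>] 0 : Filter ℝ) ≤ 𝓝[≠] 0 := nhdsGT_le_nhdsNE 0
  have hneg : Tendsto (fun s : ℝ => -s) (𝓝[>] 0) (𝓝[≠] 0) := by
    refine tendsto_nhdsWithin_iff.2 ⟨?_, ?_⟩
    · have : Tendsto (fun s : ℝ => -s) (𝓝 0) (𝓝 (-0)) := continuous_neg.tendsto 0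
      rw [neg_zero] at this
      exact this.mono_left nhdsWithin_le_nhds
    · filter_upwards [self_mem_nhdsWithin] with s hs
      simpa using (ne_of_gt hs)
  refine ⟨winding (Γ.doubleChord p q), ?_⟩
  filter_upwards [hp.filter_mono hle, hq.filter_mono hle, hneg.eventually hp, hneg.eventually hq,
    self_mem_nhdsWithin] with s h1 h2 h3 h4 (hs : 0 < s)
  rw [h1, h2, h3, h4, if_pos (mul_pos hs hz), if_neg (mul_neg_of_pos_of_neg hs hz').not_gt,
    if_pos (mul_pos_of_neg_of_neg (neg_lt_zero.2 hs) hz'),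
    if_neg (mul_neg_of_neg_of_pos (neg_lt_zero.2 hs) hz).not_gt]
  simp

end RegularCurve

end VirtualKnot

/-! ### From the index to a numbering, and from a numbering to the bijection. -/

namespace VirtualKnot

open Filter

namespace RegularCurve

variable {n : ℕ}

/-- The regular curve given by a smooth map with nonvanishing velocity. -/
noncomputable def ofContDiff (Γ : Circles n → ℂ)
    (h : ∀ i, ContDiff ℝ 1 fun t : ℝ => Γ (i, (t : UnitAddCircle)))
    (h0 : ∀ p : Circles n, deriv (fun s : ℝ => Γ (p.shift s)) 0 ≠ 0) : RegularCurve n :=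
  have hs : ∀ p : Circles n, ContDiff ℝ 1 fun s : ℝ => Γ (p.shift s) := by
    rintro ⟨i, t⟩
    obtain ⟨t, rfl⟩ := QuotientAddGroup.mk_surjective t
    exact (h i).comp (contDiff_const.add contDiff_id : ContDiff ℝ 1 fun s : ℝ => t + s)
  { toFun := Γ
    velocity := fun p => deriv (fun s : ℝ => Γ (p.shift s)) 0
    continuous_velocity := by
      refine continuous_iff_continuousAt.2 fun p => ?_
      rw [ContinuousAt, Circles.nhds_eq_map_shift, tendsto_map'_iff]
      refine (((hs p).continuous_deriv le_rfl).tendsto 0).congr fun s => ?_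
      simp only [Function.comp_apply, Circles.shift_shift]
      rw [deriv_comp_const_add (fun t => Γ (p.shift t)), add_zero]
    hasStrictDerivAt := fun p => (hs p).contDiffAt.hasStrictDerivAt one_ne_zero
    velocity_ne_zero := h0 }

end RegularCurve

namespace LinkDiagram

variable {E : Type} [NormedAddCommGroup E] [NormedSpace ℝ E]
  {S : Set E} {area : E → E → E → ℝ} (D : LinkDiagram S area)

/-- A numbering of the semiarcs that agrees on the two semiarcs to the left of each crossing and
is smaller by `1` on the two semiarcs to its right, the crossing being drawn downwards. -/
def IsNumbering (w : D.Semiarc → ℤ) : Prop :=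
  ∀ p q, D.Crossing p q → ∀ topLeft topRight botLeft botRight : D.Semiarc,
    D.RunsInto topLeft p → D.RunsInto topRight q →
    D.StartsFrom botLeft q → D.StartsFrom botRight p →
      w botLeft = w topLeft ∧ w topLeft = w topRight + 1 ∧ w topLeft = w botRight + 1

variable {D}

/-- A locally constant function off the double points descends to connected components. Its values
at the double points themselves do not matter. -/
theorem exists_isNumbering_of_locallyConstant (u : Circles D.n → ℤ)
    (hu : ∀ p ∉ D.doubleSet, ∀ᶠ q in 𝓝 p, u q = u p)
    (h : ∀ p q, D.Crossing p q → ∃ k : ℤ, ∀ᶠ s : ℝ in 𝓝[>] 0, u (p.shift (-s)) = k ∧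
      u (q.shift s) = k ∧ u (q.shift (-s)) = k - 1 ∧ u (p.shift s) = k - 1) :
    ∃ w, D.IsNumbering w := by
  have hc : Continuous fun p : {p : Circles D.n // p ∉ D.doubleSet} => u p := by
    refine continuous_iff_continuousAt.2 fun p => ?_
    rw [ContinuousAt, nhds_discrete ℤ, tendsto_pure]
    exact continuous_subtype_val.continuousAt.eventually (hu p p.2)
  have hw : ∀ a p, D.OnSemiarc a p → hc.connectedComponentsLift a = u p := by
    rintro a p ⟨hp, rfl⟩
    exact hc.connectedComponentsLift_apply_coe ⟨p, hp⟩
  refine ⟨hc.connectedComponentsLift, fun p q hpq a b c d ha hb hc' hd => ?_⟩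
  obtain ⟨k, hk⟩ := h p q hpq
  obtain ⟨s, ⟨h1, h2, h3, h4⟩, ha, hb, hc', hd⟩ := (hk.and (ha.and (hb.and (hc'.and hd)))).exists
  rw [hw _ _ ha, hw _ _ hb, hw _ _ hc', hw _ _ hd]
  omega

theorem exists_isNumbering (Γ : RegularCurve D.n) (hΓ : ∀ p q, Γ p = Γ q ↔ D.γ p = D.γ q)
    (hv : (∀ p q, D.Crossing p q → 0 < (Γ.velocity p / Γ.velocity q).im) ∨
      (∀ p q, D.Crossing p q → 0 < (Γ.velocity q / Γ.velocity p).im)) :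
    ∃ w, D.IsNumbering w := by
  have hloc : ∀ p ∉ D.doubleSet, ∀ᶠ q in 𝓝 p, Γ.index q = Γ.index p := fun p hp =>
    Γ.eventually_index_eq fun q hq h => hp ⟨q, hq, (hΓ _ _).1 h⟩
  have h3 : ∀ p q, p ≠ q → D.γ p = D.γ q → ∀ x, x ≠ p → x ≠ q → Γ x ≠ Γ p := by
    intro p q hpq hg x hp hq h
    exact D.no_triple x p q hp hpq hq ((hΓ _ _).1 h) hg
  rcases hv with hv | hv
  -- Here the index increases along the branch of p, whereas a numbering must decrease from top left
  -- to bottom right.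
  · refine exists_isNumbering_of_locallyConstant (fun p => -Γ.index p)
      (fun p hp => (hloc p hp).mono fun q hq => by rw [hq]) fun p q hpq => ?_
    obtain ⟨k, hk⟩ := Γ.exists_index_near_double_point hpq.1 ((hΓ _ _).2 hpq.2.1)
      (h3 p q hpq.1 hpq.2.1) (hv p q hpq)
    exact ⟨-k, hk.mono fun s hs => by omega⟩
  · refine exists_isNumbering_of_locallyConstant Γ.index hloc fun p q hpq => ?_
    obtain ⟨k, hk⟩ := Γ.exists_index_near_double_point hpq.1.symm ((hΓ _ _).2 hpq.2.1.symm)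
      (h3 q p hpq.1.symm hpq.2.1.symm) (hv p q hpq)
    exact ⟨k + 1, hk.mono fun s hs => by omega⟩

end LinkDiagram

namespace VirtualBiquandle

variable {X : Type*} (V : VirtualBiquandle X)

theorem map_R_zpow (k : ℤ) (x y : X) : V.R ((V.f ^ k) x, (V.f ^ k) y) =
    ((V.f ^ k) (V.R (x, y)).1, (V.f ^ k) (V.R (x, y)).2) := by
  induction k with
  | zero => simp
  | succ k ih =>
    rw [add_comm, zpow_add, zpow_one]
    simp only [Equiv.Perm.mul_apply, V.map_R, ih]
  | pred k ih =>
    rw [sub_eq_neg_add, zpow_add, zpow_neg_one, Equiv.Perm.inv_def]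
    simp only [Equiv.Perm.mul_apply, V.map_R_symm, ih]

theorem twist_R_zpow (k : ℤ) (x y : X) : V.twist.R ((V.f ^ (k + 1)) x, (V.f ^ k) y) =
    ((V.f ^ (k + 1)) (V.R (x, y)).1, (V.f ^ k) (V.R (x, y)).2) := by
  have h1 : ∀ z, V.f ((V.f ^ k) z) = (V.f ^ (k + 1)) z := fun z => by
    rw [add_comm k, zpow_add, zpow_one, Equiv.Perm.mul_apply]
  have h2 : ∀ z, V.f.symm ((V.f ^ (k + 1)) z) = (V.f ^ k) z := fun z => by
    rw [← h1, Equiv.symm_apply_apply]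
  simp only [twist, VR, Equiv.coe_fn_mk, h1, h2, map_R_zpow]

theorem twist_R_symm_zpow (k : ℤ) (x y : X) : V.twist.R.symm ((V.f ^ (k + 1)) x, (V.f ^ k) y) =
    ((V.f ^ (k + 1)) (V.R.symm (x, y)).1, (V.f ^ k) (V.R.symm (x, y)).2) := by
  rw [Equiv.symm_apply_eq, twist_R_zpow]
  simp

end VirtualBiquandle

namespace LinkDiagram

variable {E : Type} [NormedAddCommGroup E] [NormedSpace ℝ E]
  {S : Set E} {area : E → E → E → ℝ} {D : LinkDiagram S area}

/-- A numbering of the semiarcs turns the colorings by a virtual biquandle into the colorings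
by its twist. -/
def IsNumbering.coloringsEquiv {X : Type*} (V : VirtualBiquandle X) {w : D.Semiarc → ℤ}
    (hw : D.IsNumbering w) : D.virtualBiquandleColorings V ≃ D.biquandleColorings V.twist :=
  (Equiv.piCongrRight fun a => V.f ^ w a).subtypeEquiv fun c => by
    refine forall_congr' fun p => forall_congr' fun q => forall_congr' fun hpq =>
      forall_congr' fun a => forall_congr' fun b => forall_congr' fun c' => forall_congr' fun d =>
      forall_congr' fun ha => forall_congr' fun hb => forall_congr' fun hc => forall_congr' fun hd =>
      ?_
    -- Expressing all four numbers through that of the top right semiarc leaves common powers of f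
    -- on both sides of each rule, which cancel by injectivity.
    obtain ⟨e1, e2, e3⟩ := hw p q hpq a b c' d ha hb hc hd
    have e4 : w d = w b := by omega
    have hf : ∀ z, (V.f ^ (w b + 1)) z = (V.f ^ w b) (V.f z) := fun z => by
      rw [zpow_add, zpow_one, Equiv.Perm.mul_apply]
    simp only [Equiv.piCongrRight_apply, Pi.map_apply, e1, e2, e4, V.twist_R_zpow,
      V.twist_R_symm_zpow, Prod.ext_iff, EmbeddingLike.apply_eq_iff_eq, Prod.fst_swap,
      Prod.snd_swap, V.f.eq_symm_apply]
    simp only [hf, EmbeddingLike.apply_eq_iff_eq]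

end LinkDiagram

end VirtualKnot

/-! ### Diagrams in the plane. -/

namespace VirtualKnot

open Filter

theorem im_div_pos_iff {a b : ℂ} (hb : b ≠ 0) :
    0 < (a / b).im ↔ a.re * b.im - a.im * b.re < 0 := by
  have h : 0 < Complex.normSq b := Complex.normSq_pos.2 hb
  rw [Complex.div_im, ← sub_div, div_pos_iff_of_pos_right h]
  constructor <;> intro h <;> linarith

namespace LinkDiagram

variable {E : Type} [NormedAddCommGroup E] [NormedSpace ℝ E]
  {S : Set E} {area : E → E → E → ℝ} (D : LinkDiagram S area)

/-- `deriv` is 0 at points of non-differentiability, so the immersion condition already yields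
differentiability. -/
theorem hasDerivAt_shift (p : Circles D.n) :
    HasDerivAt (fun s : ℝ => D.γ (p.shift s)) (D.velocity p) 0 := by
  have h : DifferentiableAt ℝ (fun s : ℝ => D.γ (p.shift s)) 0 := by
    by_contra h
    exact D.immersion p (deriv_zero_of_not_differentiableAt h)
  exact h.hasDerivAt

theorem velocity_ne_zero (p : Circles D.n) : D.velocity p ≠ 0 := D.immersion p

end LinkDiagram

theorem PlaneLinkDiagram.exists_isNumbering (D : PlaneLinkDiagram) : ∃ w, D.IsNumbering w := by
  let L : EuclideanSpace ℝ (Fin 2) ≃L[ℝ] ℂ :=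
    Complex.orthonormalBasisOneI.repr.symm.toContinuousLinearEquiv
  have hre : ∀ x, (L x).re = x 0 := fun x => by simp [L]
  have him : ∀ x, (L x).im = x 1 := fun x => by simp [L]
  have hv : ∀ p, deriv (fun s : ℝ => L (D.γ (p.shift s))) 0 = L (D.velocity p) := fun p =>
    (L.hasFDerivAt.comp_hasDerivAt 0 (D.hasDerivAt_shift p)).deriv
  have hv0 : ∀ p, L (D.velocity p) ≠ 0 := fun p => by simpa using D.velocity_ne_zero p
  refine LinkDiagram.exists_isNumbering (RegularCurve.ofContDiff (fun p => L (D.γ p))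
    (fun i => (L.contDiff.comp (D.smooth i)).of_le (by exact_mod_cast le_top))
    fun p => by rw [hv]; exact hv0 p) (fun p q => by simp [RegularCurve.ofContDiff]) (Or.inl ?_)
  intro p q hpq
  simp only [RegularCurve.ofContDiff, hv]
  rw [im_div_pos_iff (hv0 q)]
  simpa [hre, him] using hpq.2.2

/-! ### Diagrams on the sphere. -/

/-- The stereographic projection from the north pole of the unit sphere, as a function of three
coordinates. -/
noncomputable def stereo (x : Fin 3 → ℝ) : ℂ := ⟨x 0 / (1 - x 2), x 1 / (1 - x 2)⟩

/-- The derivative of `stereo` at `x` in the direction `u`. -/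
noncomputable def stereoDeriv (x u : Fin 3 → ℝ) : ℂ :=
  ⟨(u 0 * (1 - x 2) + x 0 * u 2) / (1 - x 2) ^ 2, (u 1 * (1 - x 2) + x 1 * u 2) / (1 - x 2) ^ 2⟩

theorem stereo_injOn {x y : Fin 3 → ℝ} (hx : x 0 ^ 2 + x 1 ^ 2 + x 2 ^ 2 = 1)
    (hy : y 0 ^ 2 + y 1 ^ 2 + y 2 ^ 2 = 1) (hx2 : 1 - x 2 ≠ 0) (hy2 : 1 - y 2 ≠ 0)
    (h : stereo x = stereo y) : x = y := by
  obtain ⟨h0, h1⟩ := Complex.ext_iff.1 h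
  simp only [stereo] at h0 h1
  -- The height is recovered from the image w by 1 - z₂ = 2 / (|w|² + 1).
  have hs : ∀ z : Fin 3 → ℝ, z 0 ^ 2 + z 1 ^ 2 + z 2 ^ 2 = 1 → 1 - z 2 ≠ 0 →
      1 - z 2 = 2 / ((z 0 / (1 - z 2)) ^ 2 + (z 1 / (1 - z 2)) ^ 2 + 1) := by
    intro z hz hz2
    have e : (z 0 / (1 - z 2)) ^ 2 + (z 1 / (1 - z 2)) ^ 2 + 1 = 2 / (1 - z 2) := by
      field_simp
      linear_combination hz
    rw [e]
    field_simp
  have h2 : 1 - x 2 = 1 - y 2 := by rw [hs x hx hx2, hs y hy hy2, h0, h1]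
  rw [h2, div_left_inj' hy2] at h0 h1
  funext i
  fin_cases i
  · exact h0
  · exact h1
  · simpa using h2

theorem stereoDeriv_ne_zero {x u : Fin 3 → ℝ} (hx : x 0 ^ 2 + x 1 ^ 2 + x 2 ^ 2 = 1)
    (hu : x 0 * u 0 + x 1 * u 1 + x 2 * u 2 = 0) (hx2 : 1 - x 2 ≠ 0) (hu0 : u ≠ 0) :
    stereoDeriv x u ≠ 0 := by
  intro h
  obtain ⟨h0, h1⟩ := Complex.ext_iff.1 h
  simp only [stereoDeriv, Complex.zero_re, Complex.zero_im, div_eq_zero_iff, pow_eq_zero_iff,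
    hx2, or_false, ne_eq, OfNat.ofNat_ne_zero, not_false_eq_true] at h0 h1
  have h2 : (1 - x 2) * u 2 = 0 := by
    linear_combination x 0 * h0 + x 1 * h1 - (1 - x 2) * hu - u 2 * hx
  have h2 := (mul_eq_zero.1 h2).resolve_left hx2
  simp only [h2, mul_zero, add_zero, mul_eq_zero, hx2, or_false] at h0 h1
  apply hu0
  funext i
  fin_cases i
  · exact h0
  · exact h1
  · exact h2

theorem det_stereoDeriv {x u v : Fin 3 → ℝ} (hx : x 0 ^ 2 + x 1 ^ 2 + x 2 ^ 2 = 1)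
    (hu : x 0 * u 0 + x 1 * u 1 + x 2 * u 2 = 0) (hv : x 0 * v 0 + x 1 * v 1 + x 2 * v 2 = 0)
    (hx2 : 1 - x 2 ≠ 0) :
    (stereoDeriv x u).re * (stereoDeriv x v).im - (stereoDeriv x u).im * (stereoDeriv x v).re =
      -Matrix.det !![x 0, x 1, x 2; u 0, u 1, u 2; v 0, v 1, v 2] / (1 - x 2) ^ 2 := by
  -- The cross product of two tangent vectors is normal to the sphere, hence det times x; this is
  -- its third coordinate.
  have key : u 0 * v 1 - u 1 * v 0 =
      x 2 * Matrix.det !![x 0, x 1, x 2; u 0, u 1, u 2; v 0, v 1, v 2] := by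
    simp only [Matrix.det_fin_three, Matrix.of_apply, Matrix.cons_val', Matrix.cons_val_zero,
      Matrix.cons_val_one, Matrix.cons_val]
    linear_combination (-(u 0 * v 1 - u 1 * v 0)) * hx + (x 0 * v 1 - x 1 * v 0) * hu +
      (x 1 * u 0 - x 0 * u 1) * hv
  simp only [stereoDeriv]
  rw [div_mul_div_comm, div_mul_div_comm, ← sub_div, div_eq_div_iff (by positivity) (by positivity)]
  have e : (u 0 * (1 - x 2) + x 0 * u 2) * (v 1 * (1 - x 2) + x 1 * v 2) -
      (u 1 * (1 - x 2) + x 1 * u 2) * (v 0 * (1 - x 2) + x 0 * v 2) = (1 - x 2) *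
      ((u 0 * v 1 - u 1 * v 0) - Matrix.det !![x 0, x 1, x 2; u 0, u 1, u 2; v 0, v 1, v 2]) := by
    simp only [Matrix.det_fin_three, Matrix.of_apply, Matrix.cons_val', Matrix.cons_val_zero,
      Matrix.cons_val_one, Matrix.cons_val]
    ring
  rw [e, key]
  ring

theorem hasDerivAt_stereo {c : ℝ → Fin 3 → ℝ} {u : Fin 3 → ℝ} {t : ℝ}
    (hc : HasDerivAt c u t) (h2 : 1 - c t 2 ≠ 0) :
    HasDerivAt (fun s => stereo (c s)) (stereoDeriv (c t) u) t := by
  have h := hasDerivAt_pi.1 hc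
  have hd : HasDerivAt (fun s => 1 - c s 2) (-u 2) t := (h 2).const_sub 1
  have e : (fun s => stereo (c s)) = fun s =>
      ((c s 0 / (1 - c s 2) : ℝ) : ℂ) + ((c s 1 / (1 - c s 2) : ℝ) : ℂ) * Complex.I := by
    funext s
    exact Complex.mk_eq_add_mul_I _ _
  rw [e]
  refine (((h 0).div hd h2).ofReal_comp.add
    (((h 1).div hd h2).ofReal_comp.mul_const Complex.I)).congr_deriv ?_
  rw [Complex.ext_iff]
  constructor
  · simp only [stereoDeriv, Complex.add_re, Complex.mul_re, Complex.ofReal_re, Complex.ofReal_im,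
      Complex.I_re, Complex.I_im]
    ring
  · simp only [stereoDeriv, Complex.add_im, Complex.mul_im, Complex.ofReal_re, Complex.ofReal_im,
      Complex.I_re, Complex.I_im]
    ring

theorem contDiff_stereo {c : ℝ → Fin 3 → ℝ} (hc : ContDiff ℝ 1 c) (h2 : ∀ t, 1 - c t 2 ≠ 0) :
    ContDiff ℝ 1 fun s => stereo (c s) := by
  have h := contDiff_pi.1 hc
  have hd : ContDiff ℝ 1 fun s => 1 - c s 2 := contDiff_const.sub (h 2)
  have e : (fun s => stereo (c s)) = fun s =>
      ((c s 0 / (1 - c s 2) : ℝ) : ℂ) + ((c s 1 / (1 - c s 2) : ℝ) : ℂ) * Complex.I := by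
    funext s
    exact Complex.mk_eq_add_mul_I _ _
  rw [e]
  exact (Complex.ofRealCLM.contDiff.comp ((h 0).div hd h2)).add
    ((Complex.ofRealCLM.contDiff.comp ((h 1).div hd h2)).mul contDiff_const)

/-- Finitely many closed curves of class `C¹` do not cover the unit sphere. -/
theorem exists_mem_sphere_notMem_range {n : ℕ} (γ : Circles n → EuclideanSpace ℝ (Fin 3))
    (h : ∀ i, ContDiff ℝ 1 fun t : ℝ => γ (i, (t : UnitAddCircle))) :
    ∃ N : EuclideanSpace ℝ (Fin 3), ‖N‖ = 1 ∧ ∀ p, γ p ≠ N := by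
  let P : EuclideanSpace ℝ (Fin 3) →L[ℝ] ℝ × ℝ :=
    (EuclideanSpace.proj 0).prod (EuclideanSpace.proj 1)
  -- A C¹ curve has Hausdorff dimension at most 1, so the shadows of the curves in the plane of the
  -- first two coordinates have dense complement.
  have hdim : dimH (⋃ i, Set.range fun t : ℝ => P (γ (i, (t : UnitAddCircle)))) <
      (Module.finrank ℝ (ℝ × ℝ) : ENNReal) := by
    rw [dimH_iUnion]
    refine (iSup_le fun i => (P.contDiff.comp (h i)).dimH_range_le).trans_lt ?_
    simp
  -- In the sup norm, radius 1/2 gives z₁² + z₂² ≤ 1, so z lifts to the upper hemisphere; the lift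
  -- is missed because its shadow is.
  obtain ⟨z, hz, hzn⟩ := (dense_compl_of_dimH_lt_finrank hdim).exists_mem_open
    (Metric.isOpen_ball (x := (0 : ℝ × ℝ)) (ε := 1 / 2)) ⟨0, by simp⟩
  rw [mem_ball_zero_iff, Prod.norm_def, max_lt_iff] at hzn
  have h1 : z.1 ^ 2 + z.2 ^ 2 ≤ 1 := by
    have a := abs_lt.1 hzn.1
    have b := abs_lt.1 hzn.2
    nlinarith
  refine ⟨!₂[z.1, z.2, √(1 - z.1 ^ 2 - z.2 ^ 2)], ?_, fun p hp => ?_⟩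
  · rw [EuclideanSpace.norm_eq, Real.sqrt_eq_one]
    simp only [Fin.sum_univ_three, Real.norm_eq_abs, sq_abs]
    simp [Real.sq_sqrt (show 0 ≤ 1 - z.1 ^ 2 - z.2 ^ 2 by linarith)]
  · obtain ⟨i, t⟩ := p
    obtain ⟨t, rfl⟩ := QuotientAddGroup.mk_surjective t
    refine hz (Set.mem_iUnion.2 ⟨i, t, ?_⟩)
    change P (γ (i, (t : UnitAddCircle))) = z
    erw [hp]
    simp [P]

/-- A rotation or reflection multiplies oriented volumes by a nonzero constant. -/
theorem exists_det_map_eq (T : EuclideanSpace ℝ (Fin 3) ≃ₗᵢ[ℝ] EuclideanSpace ℝ (Fin 3)) :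
    ∃ d : ℝ, d ≠ 0 ∧ ∀ x u v, Matrix.det !![T x 0, T x 1, T x 2; T u 0, T u 1, T u 2;
      T v 0, T v 1, T v 2] = d * Matrix.det !![x 0, x 1, x 2; u 0, u 1, u 2; v 0, v 1, v 2] := by
  let e := (EuclideanSpace.basisFun (Fin 3) ℝ).toBasis
  have he : ∀ x u v : EuclideanSpace ℝ (Fin 3), e.det ![x, u, v] =
      Matrix.det !![x 0, x 1, x 2; u 0, u 1, u 2; v 0, v 1, v 2] := by
    intro x u v
    rw [Module.Basis.det_apply, ← Matrix.det_transpose]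
    congr 1
    ext i j
    fin_cases i <;> fin_cases j <;> simp [e, Module.Basis.toMatrix_apply]
  refine ⟨LinearMap.det (T.toLinearEquiv : _ →ₗ[ℝ] EuclideanSpace ℝ (Fin 3)),
    T.toLinearEquiv.isUnit_det'.ne_zero, fun x u v => ?_⟩
  rw [← he, ← he, ← Module.Basis.det_comp]
  congr 1
  funext i
  fin_cases i <;> rfl

theorem SphereLinkDiagram.exists_isNumbering (D : SphereLinkDiagram) : ∃ w, D.IsNumbering w := by
  have hsm : ∀ i, ContDiff ℝ 1 fun t : ℝ => D.γ (i, (t : UnitAddCircle)) := fun i =>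
    (D.smooth i).of_le (by exact_mod_cast le_top)
  obtain ⟨N, hN, hNγ⟩ := exists_mem_sphere_notMem_range D.γ hsm
  obtain ⟨T, hT⟩ : ∃ T : EuclideanSpace ℝ (Fin 3) ≃ₗᵢ[ℝ] EuclideanSpace ℝ (Fin 3),
      T N = EuclideanSpace.single 2 1 :=
    -- The reflection in the perpendicular bisector plane of N and the north pole moves the missed
    -- point to the pole; it is the identity if they coincide.
    ⟨(ℝ ∙ (N - EuclideanSpace.single 2 1))ᗮ.reflection,
      Submodule.reflection_sub (by rw [hN]; simp)⟩
  obtain ⟨d, hd0, hd⟩ := exists_det_map_eq T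
  let L : EuclideanSpace ℝ (Fin 3) →L[ℝ] Fin 3 → ℝ :=
    (EuclideanSpace.equiv (Fin 3) ℝ : EuclideanSpace ℝ (Fin 3) →L[ℝ] Fin 3 → ℝ).comp
      (T.toContinuousLinearEquiv : EuclideanSpace ℝ (Fin 3) →L[ℝ] EuclideanSpace ℝ (Fin 3))
  have hL : ∀ x i, L x i = T x i := fun x i => rfl
  have hLinj : Function.Injective L := (EuclideanSpace.equiv (Fin 3) ℝ).injective.comp T.injective
  have hsph : ∀ p, L (D.γ p) 0 ^ 2 + L (D.γ p) 1 ^ 2 + L (D.γ p) 2 ^ 2 = 1 := by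
    intro p
    have h1 : ‖T (D.γ p)‖ = 1 := by
      rw [T.norm_map]
      simpa using D.mem_surface p
    rw [EuclideanSpace.norm_eq, Real.sqrt_eq_one] at h1
    simpa only [Fin.sum_univ_three, Real.norm_eq_abs, sq_abs, hL] using h1
  have h2 : ∀ p, 1 - L (D.γ p) 2 ≠ 0 := by
    intro p h
    have e2 : L (D.γ p) 2 = 1 := by linarith
    have hs := hsph p
    rw [e2] at hs
    have e0 : L (D.γ p) 0 = 0 := by nlinarith [sq_nonneg (L (D.γ p) 1)]
    have e1 : L (D.γ p) 1 = 0 := by nlinarith [sq_nonneg (L (D.γ p) 0)]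
    refine hNγ p (T.injective ?_)
    rw [hT]
    ext i
    fin_cases i
    · simpa [hL] using e0
    · simpa [hL] using e1
    · simpa [hL] using e2
  have hder : ∀ p, HasDerivAt (fun s : ℝ => L (D.γ (p.shift s))) (L (D.velocity p)) 0 := fun p =>
    L.hasFDerivAt.comp_hasDerivAt 0 (D.hasDerivAt_shift p)
  have htan : ∀ p, L (D.γ p) 0 * L (D.velocity p) 0 + L (D.γ p) 1 * L (D.velocity p) 1 +
      L (D.γ p) 2 * L (D.velocity p) 2 = 0 := by
    intro p
    have h := hasDerivAt_pi.1 (hder p)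
    have h1 := (((h 0).pow 2).add ((h 1).pow 2)).add ((h 2).pow 2)
    have h3 : HasDerivAt (fun _ : ℝ => (1 : ℝ)) 0 0 := hasDerivAt_const _ _
    have h4 := h1.unique (h3.congr_of_eventuallyEq (Eventually.of_forall fun s => hsph _))
    simp only [Circles.shift_zero, Nat.cast_ofNat] at h4
    linear_combination h4 / 2
  have hv : ∀ p, deriv (fun s : ℝ => stereo (L (D.γ (p.shift s)))) 0 =
      stereoDeriv (L (D.γ p)) (L (D.velocity p)) := by
    intro p
    have := hasDerivAt_stereo (hder p) (h2 _)
    rw [Circles.shift_zero] at this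
    exact this.deriv
  have hv0 : ∀ p, stereoDeriv (L (D.γ p)) (L (D.velocity p)) ≠ 0 := fun p =>
    stereoDeriv_ne_zero (hsph p) (htan p) (h2 p) fun h =>
      D.velocity_ne_zero p (hLinj (h.trans (map_zero L).symm))
  have hsign : ∀ p q, D.γ p = D.γ q →
      (0 < (stereoDeriv (L (D.γ p)) (L (D.velocity p)) /
        stereoDeriv (L (D.γ q)) (L (D.velocity q))).im ↔
      0 < d * Matrix.det !![D.γ p 0, D.γ p 1, D.γ p 2; D.velocity p 0, D.velocity p 1,
        D.velocity p 2; D.velocity q 0, D.velocity q 1, D.velocity q 2]) := by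
    intro p q hpq
    have hq := htan q
    rw [← hpq] at hq
    rw [im_div_pos_iff (hv0 q), ← hpq, det_stereoDeriv (hsph p) (htan p) hq (h2 p), ← hd]
    simp only [hL]
    rw [neg_div, neg_lt_zero, div_pos_iff_of_pos_right (by have := h2 p; positivity)]
  refine LinkDiagram.exists_isNumbering (RegularCurve.ofContDiff (fun p => stereo (L (D.γ p)))
    (fun i => contDiff_stereo (L.contDiff.comp (hsm i)) fun t => h2 _)
    fun p => by rw [hv]; exact hv0 p) (fun p q => ?_) ?_
  · simp only [RegularCurve.ofContDiff]
    exact ⟨fun h => hLinj (stereo_injOn (hsph p) (hsph q) (h2 p) (h2 q) h), fun h => by rw [h]⟩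
  · simp only [RegularCurve.ofContDiff, hv]
    -- The sign of d tells whether the isometry preserves orientation. Stereographic projection from
    -- the pole reverses the outward orientation, so all crossings get the same sign in either case.
    rcases lt_or_gt_of_ne hd0 with hd' | hd'
    · left
      intro p q hpq
      rw [hsign p q hpq.2.1]
      exact mul_pos_of_neg_of_neg hd' hpq.2.2
    · right
      intro p q hpq
      rw [hsign q p hpq.2.1.symm]
      refine mul_pos hd' ?_
      have := hpq.2.2
      rw [hpq.2.1] at this
      simp only [Matrix.det_fin_three, Matrix.of_apply, Matrix.cons_val', Matrix.cons_val_zero,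
        Matrix.cons_val_one, Matrix.cons_val] at this ⊢
      linarith

end VirtualKnot

theorem theorem3p2 {X : Type*} (V : VirtualKnot.VirtualBiquandle X) :
    (∀ D : VirtualKnot.PlaneLinkDiagram,
      Nonempty (D.virtualBiquandleColorings V ≃ D.biquandleColorings V.twist)) ∧
    (∀ D : VirtualKnot.SphereLinkDiagram,
      Nonempty (D.virtualBiquandleColorings V ≃ D.biquandleColorings V.twist)) :=
  ⟨fun D => (VirtualKnot.PlaneLinkDiagram.exists_isNumbering D).elim fun _ hw =>
      ⟨hw.coloringsEquiv V⟩,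
    fun D => (VirtualKnot.SphereLinkDiagram.exists_isNumbering D).elim fun _ hw =>
      ⟨hw.coloringsEquiv V⟩⟩
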